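/- Let $\mathsf X$ and $\mathsf B$ be categories with (chosen) finite products and let $P\colon \mathsf X\to\mathsf B$ be an opfibration which strictly preserves them, i.e. $P$ sends the chosen terminal object and the chosen binary product diagrams of $\mathsf X$ to those of $\mathsf B$. Call a morphism of $\mathsf X$ $P$-vertical if $P$ sends it to an identity. Let $Q\colon\mathsf X\to\mathsf Q$ be the category of fractions of $\mathsf X$ with respect to the class of $P$-vertical morphisms, and let $\overline P\colon\mathsf Q\to\mathsf B$ be the unique functor with $\overline P\, Q=P$. Then $\mathsf Q$ has finite products, which can be chosen so that $Q$ strictly preserves them, and with respect to them $\overline P$ is a cartesian monoidal opfibration with groupoidal fibres. That is: $\overline P$ is an opfibration which strictly preserves finite products, the product of two $\overline P$-cocartesian morphisms is $\overline P$-cocartesian, and for every object $b$ of $\mathsf B$ the fibre $\overline P_b$ (objects over $b$, morphisms over $1_b$) is a groupoid. If moreover $\mathsf B$ is additive, then the fibres $\overline P_b$ carry symmetric monoidal structures, induced by the products of $\mathsf Q$ and the canonical commutative monoid structures $+\colon b\times b\to b$, $0\colon 1\to b$ of the objects of $\mathsf B$, such that: (a) each fibre is a symmetric $2$-group, i.e.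 a symmetric monoidal groupoid in which every object $x$ has an object $y$ with $x\otimes y\cong I\cong y\otimes x$; (b) for every $f\colon b\to b'$ in $\mathsf B$ and every choice of cocartesian lifts $\ell_x\colon x\to f_*x$ of $f$, the resulting change-of-base functor $f_*\colon\overline P_b\to\overline P_{b'}$ is symmetric (strong) monoidal, with a structure for which $\ell$ is a monoidal natural transformation between the inclusions into $\mathsf Q$. Here "induced" means that the inclusion $\overline P_b\to\mathsf Q$ is equipped with a lax symmetric monoidal structure whose components $x\times y\to x\otimes y$ are $\overline P$-cocartesian over $+\colon b\times b\to b$ and whose unit $1\to I$ is $\overline P$-cocartesian over $0\colon 1\to b$. -/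

import Mathlib

open CategoryTheory MonoidalCategory CartesianMonoidalCategory Functor

universe v₁ v₂ u₁ u₂

namespace CatFractions

/-- A functor between categories with chosen finite products (given by cartesian monoidal
structures) strictly preserves finite products if it sends the chosen terminal object to the chosen
terminal object and the chosen binary product diagrams to the chosen binary product diagrams. -/
structure StrictlyPreservesFiniteProducts {C : Type u₁} [Category.{v₁} C] {D : Type u₂}
    [Category.{v₂} D] [CartesianMonoidalCategory C] [CartesianMonoidalCategory D]
    (F : C ⥤ D) : Prop where
  obj_unit : F.obj (𝟙_ C) = 𝟙_ D
  obj_tensor (x y : C) : F.obj (x ⊗ y) = F.obj x ⊗ F.obj y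
  map_fst (x y : C) : F.map (fst x y) = eqToHom (obj_tensor x y) ≫ fst (F.obj x) (F.obj y)
  map_snd (x y : C) : F.map (snd x y) = eqToHom (obj_tensor x y) ≫ snd (F.obj x) (F.obj y)

section Opfibrations

variable {E : Type u₁} [Category.{v₁} E] {B : Type u₂} [Category.{v₂} B]

/-- A functor is an opfibration if every arrow `P x ⟶ b` in the base has a cocartesian lift
with domain `x`. (Cocartesian morphisms with their full universal property are called
strongly cocartesian in Mathlib.) -/
def IsOpfibration (P : E ⥤ B) : Prop :=
  ∀ ⦃x : E⦄ ⦃b : B⦄ (f : P.obj x ⟶ b), ∃ (y : E) (φ : x ⟶ y), P.IsStronglyCocartesian f φ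

/-- A cartesian monoidal opfibration: an opfibration which strictly preserves
finite products and such that the product of two cocartesian morphisms is cocartesian. -/
structure IsCartesianMonoidalOpfibration [CartesianMonoidalCategory E]
    [CartesianMonoidalCategory B] (P : E ⥤ B) : Prop where
  isOpfibration : IsOpfibration P
  strict : StrictlyPreservesFiniteProducts P
  cocartesian_tensor {x x' y y' : E} (φ : x ⟶ x') (ψ : y ⟶ y')
    (hφ : P.IsStronglyCocartesian (P.map φ) φ) (hψ : P.IsStronglyCocartesian (P.map ψ) ψ) :
    P.IsStronglyCocartesian (P.map (φ ⊗ₘ ψ)) (φ ⊗ₘ ψ)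

/-- The fibres of `P` are groupoids. -/
def HasGroupoidalFibres (P : E ⥤ B) : Prop := ∀ b : B, IsGroupoid (Fiber P b)

/-- The class of `P`-vertical morphisms: those which `P` sends to an identity. -/
def vertical (P : E ⥤ B) : MorphismProperty E := fun x _ φ => P.IsHomLift (𝟙 (P.obj x)) φ

lemma vertical_isInvertedBy (P : E ⥤ B) : (vertical P).IsInvertedBy P := by
  intro x y φ hφ
  have : P.IsHomLift (𝟙 (P.obj x)) φ := hφ
  rw [IsHomLift.fac' P (𝟙 (P.obj x)) φ]
  infer_instance

/-- The category of fractions of `E` with respect to the `P`-vertical morphisms. -/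
abbrev Fractions (P : E ⥤ B) := (vertical P).Localization

/-- The canonical functor from `E` to its category of fractions. -/
abbrev toFractions (P : E ⥤ B) : E ⥤ Fractions P := (vertical P).Q

/-- The factorization of `P` through the category of fractions. -/
noncomputable def fractionsFunctor (P : E ⥤ B) : Fractions P ⥤ B :=
  Localization.Construction.lift P (vertical_isInvertedBy P)

lemma toFractions_comp_fractionsFunctor (P : E ⥤ B) :
    toFractions P ⋙ fractionsFunctor P = P :=
  Localization.Construction.fac P (vertical_isInvertedBy P)

lemma fractionsFunctor_unique (P : E ⥤ B) (G : Fractions P ⥤ B) (hG : toFractions P ⋙ G = P) :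
    G = fractionsFunctor P :=
  Localization.Construction.uniq _ _ (hG.trans (toFractions_comp_fractionsFunctor P).symm)

/-- A choice of cocartesian lifts of `f : b ⟶ b'` at all objects of the fibre over `b`. -/
structure CocartesianLifts (P : E ⥤ B) {b b' : B} (f : b ⟶ b') where
  obj : Fiber P b → Fiber P b'
  lift (x : Fiber P b) : x.1 ⟶ (obj x).1
  cocartesian (x : Fiber P b) : P.IsStronglyCocartesian f (lift x)

namespace CocartesianLifts

attribute [instance] CocartesianLifts.cocartesian

lemma nonempty {P : E ⥤ B} (hP : IsOpfibration P) {b b' : B} (f : b ⟶ b') :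
    Nonempty (CocartesianLifts P f) := by
  have key : ∀ x : Fiber P b, ∃ (y : Fiber P b') (φ : x.1 ⟶ y.1),
      P.IsStronglyCocartesian f φ := by
    rintro ⟨x, rfl⟩
    obtain ⟨y, φ, h⟩ := hP f
    exact ⟨⟨y, IsHomLift.codomain_eq P f φ⟩, φ, h⟩
  choose o l h using key
  exact ⟨⟨o, l, h⟩⟩

variable {P : E ⥤ B} {b b' : B} {f : b ⟶ b'} (L : CocartesianLifts P f)

lemma exists_unique_map {x y : Fiber P b} (φ : x ⟶ y) :
    ∃! χ : L.obj x ⟶ L.obj y, L.lift x ≫ χ.1 = φ.1 ≫ L.lift y := by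
  have := φ.2
  obtain ⟨χ, ⟨h₁, h₂⟩, h₃⟩ := IsStronglyCocartesian.universal_property P f (L.lift x) (𝟙 b') f
    (by simp) (φ.1 ≫ L.lift y)
  exact ⟨⟨χ, h₁⟩, h₂, fun ψ hψ => Subtype.ext (h₃ ψ.1 ⟨ψ.2, hψ⟩)⟩

/-- The change-of-base functor along `f` determined by a choice of cocartesian lifts: on vertical
morphisms it is given by the universal property of the lifts. -/
noncomputable def changeOfBase : Fiber P b ⥤ Fiber P b' where
  obj := L.obj
  map φ := (L.exists_unique_map φ).choose
  map_id x := ((L.exists_unique_map (𝟙 x)).choose_spec.2 (𝟙 _)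
    ((Category.comp_id _).trans (Category.id_comp _).symm)).symm
  map_comp {x y z} φ ψ := by
    have h := (L.exists_unique_map φ).choose_spec.1
    have h' := (L.exists_unique_map ψ).choose_spec.1
    refine ((L.exists_unique_map (φ ≫ ψ)).choose_spec.2 _ ?_).symm
    change L.lift x ≫ (L.exists_unique_map φ).choose.1 ≫ (L.exists_unique_map ψ).choose.1 =
      (φ.1 ≫ ψ.1) ≫ L.lift z
    rw [reassoc_of% h, h', Category.assoc]

/-- The chosen cocartesian lifts, as a natural transformation from the inclusion of the fibre
over `b` to the change-of-base functor followed by the inclusion of the fibre over `b'`. -/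
noncomputable def liftNatTrans :
    (Fiber.fiberInclusion : Fiber P b ⥤ E) ⟶ L.changeOfBase ⋙ Fiber.fiberInclusion where
  app := L.lift
  naturality _ _ φ := (L.exists_unique_map φ).choose_spec.1.symm

end CocartesianLifts

end Opfibrations

section Fibres

/-- A symmetric `2`-group: a symmetric monoidal category which is a groupoid and
in which every object is invertible, up to isomorphism, for the tensor product. -/
structure IsSymmetricTwoGroup (G : Type u₁) [Category.{v₁} G] [MonoidalCategory G]
    [SymmetricCategory G] : Prop where
  isGroupoid : IsGroupoid G
  exists_inverse (x : G) : ∃ y : G, Nonempty (x ⊗ y ≅ 𝟙_ G) ∧ Nonempty (y ⊗ x ≅ 𝟙_ G)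

variable {E : Type u₁} [Category.{v₁} E] {B : Type u₂} [Category.{v₂} B]
  [CartesianMonoidalCategory E] [BraidedCategory E]
  [CartesianMonoidalCategory B] [Preadditive B]

/-- A symmetric monoidal structure on the fibre of `P` over `b` induced by the commutative monoid
structure of `b` in the additive category `B`, whose addition is `fst + snd : b ⊗ b ⟶ b`
and whose unit is `0 : 𝟙_ B ⟶ b`.
The tensor product of `x` and `y` is the codomain of a cocartesian morphism
`μ : x × y ⟶ x ⊗ y` over the addition of `b`, the unit object is the codomain of a cocartesian
morphism `ε : 1 ⟶ I` over the zero of `b`, and the action of the tensor product on morphisms, the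
associator, the unitors and the symmetry are induced by those of the finite products
of `E`; the latter compatibilities say precisely that `μ` and `ε` make the inclusion of
the fibre in `E` a lax symmetric monoidal functor. (The braiding of `E` is necessarily the usual
symmetry of the product, since a cartesian monoidal category has exactly one braiding.) -/
structure InducedSymmetricMonoidalStructure (P : E ⥤ B) (b : B) where
  [monoidal : MonoidalCategory (Fiber P b)]
  [symmetric : SymmetricCategory (Fiber P b)]
  [lax : (Fiber.fiberInclusion : Fiber P b ⥤ E).LaxBraided]
  ε_cocartesian : P.IsStronglyCocartesian (0 : 𝟙_ B ⟶ b)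
    (LaxMonoidal.ε (Fiber.fiberInclusion : Fiber P b ⥤ E))
  μ_cocartesian (x y : Fiber P b) : P.IsStronglyCocartesian (fst b b + snd b b : b ⊗ b ⟶ b)
    (LaxMonoidal.μ (Fiber.fiberInclusion : Fiber P b ⥤ E) x y)

/-- The induced symmetric monoidal structure is a symmetric `2`-group. -/
def InducedSymmetricMonoidalStructure.IsTwoGroup {P : E ⥤ B} {b : B}
    (S : InducedSymmetricMonoidalStructure P b) : Prop :=
  letI := S.monoidal
  letI := S.symmetric
  IsSymmetricTwoGroup (Fiber P b)

/-- The change-of-base functor determined by the cocartesian lifts `L` carries a structure of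
(strong) symmetric monoidal functor for the structures `S` and `S'` on the fibres,
and this structure is the canonical one, i.e. the cocartesian lifts form
a monoidal natural transformation. -/
def CocartesianLifts.IsSymmetricMonoidal {P : E ⥤ B} {b b' : B} {f : b ⟶ b'}
    (L : CocartesianLifts P f) (S : InducedSymmetricMonoidalStructure P b)
    (S' : InducedSymmetricMonoidalStructure P b') : Prop :=
  letI := S.monoidal
  letI := S.symmetric
  letI := S.lax
  letI := S'.monoidal
  letI := S'.symmetric
  letI := S'.lax
  ∃ _ : L.changeOfBase.Braided, NatTrans.IsMonoidal L.liftNatTrans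

end Fibres

end CatFractions

/-!
The whole statement rests on one fact: in the category of fractions `Fractions P` *every* morphism
is cocartesian over `B`.

A morphism of `X` is a cocartesian morphism followed by a vertical one, and a formal inverse of a
vertical morphism can be moved past a cocartesian morphism by pushing the vertical one forward. So
a morphism of fractions `x ⟶ y` has a normal form: a morphism `f` of the base together with a
vertical morphism of fractions `f_* x ⟶ y`. Zigzags need not be inspected to show that every
morphism has a normal form, depending naturally on its source. For fixed `y`, the normal forms
`x ⟶ y` form a presheaf on `X`, in which `φ : x ⟶ x'` acts through the vertical comparison
`(P φ ≫ f)_* x ⟶ f_* x'`. As this comparison is invertible in the category of fractions, vertical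
morphisms act bijectively, and the presheaf descends to `Fractions P`. Acting on the normal form of
the identity of `y` gives a section of the evaluation of normal forms
(`Cleavage.NormalForm.eval_ofHom`), compatible with precomposition, and precomposition by `φ`
identifies the normal forms with base `g` with those with base `P φ ≫ g`. This is the
universal property of a cocartesian morphism
(`IsOpfibration.isStronglyCocartesian_toFractions_map`). Consequently a vertical morphism of
fractions is invertible, and products of cocartesian morphisms are trivially cocartesian.

For the products, the category of fractions is also the localization at the morphisms lying over
isomorphisms (`IsOpfibration.isLocalization_toFractions`). This class is stable under finite
products, so the quotient functor preserves them, and the products of `X` serve as chosen products.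

Let now `B` be additive. A lift of the addition of `b` at `x × y`, together with a lift of zero,
lets one add generalized elements `u : w ⟶ x` and `v : w ⟶ y` of objects of the fibre over `b`; if
these lie over `f` and `g`, the sum lies over `f + g`. Two morphisms with the same domain which lie
over the same morphism have uniquely isomorphic codomains (`AllCocartesian.exists_fiber_iso`,
`AllCocartesian.fiber_hom_ext`). Hence every identity satisfied by the addition of `b`
(associativity, unit, commutativity, inverses, additivity of `f : b ⟶ b'`) yields a constraint
isomorphism, and each coherence diagram commutes because it does so on generalized elements.
-/

namespace CatFractions

/-! ### Normal forms of fractions, and cocartesian morphisms -/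

lemma isHomLift_unique {E : Type u₁} [Category.{v₁} E] {B : Type u₂} [Category.{v₂} B] (p : E ⥤ B)
    {a b : B} {x y : E} (φ : x ⟶ y) (f g : a ⟶ b) [p.IsHomLift f φ] [p.IsHomLift g φ] : f = g :=
  (IsHomLift.fac p f φ).trans (IsHomLift.fac p g φ).symm

/-- Every morphism of `E` is cocartesian. For an opfibration, this says that the fibres are
groupoids. -/
def AllCocartesian {E : Type u₁} [Category.{v₁} E] {B : Type u₂} [Category.{v₂} B]
    (p : E ⥤ B) : Prop :=
  ∀ ⦃x y : E⦄ (u : x ⟶ y), p.IsStronglyCocartesian (p.map u) u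

section Cocartesian

variable {X : Type u₁} [Category.{v₁} X] {B : Type u₂} [Category.{v₂} B] (P : X ⥤ B)

lemma fractionsFunctor_map {x y : X} (φ : x ⟶ y) :
    (fractionsFunctor P).map ((toFractions P).map φ) = P.map φ := by
  -- The `eqToHom`s produced by `congr_hom` are identities by definition.
  exact (Functor.congr_hom (toFractions_comp_fractionsFunctor P) φ).trans
    ((Category.id_comp _).trans (Category.comp_id _))

instance toFractions_isHomLift {a b : B} (f : a ⟶ b) {x y : X} (φ : x ⟶ y) [P.IsHomLift f φ] :
    (fractionsFunctor P).IsHomLift f ((toFractions P).map φ) := by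
  subst_hom_lift P f φ
  rw [← fractionsFunctor_map]
  exact .map _

/-- Being vertical does not depend on the name of the object whose identity is lifted. -/
lemma vertical_of_isHomLift {b : B} {x y : X} (φ : x ⟶ y) (h : P.IsHomLift (𝟙 b) φ) :
    vertical P φ := by
  obtain rfl := IsHomLift.domain_eq P (𝟙 b) φ
  exact h

lemma isIso_toFractions_map {b : B} {x y : X} (φ : x ⟶ y) [h : P.IsHomLift (𝟙 b) φ] :
    IsIso ((toFractions P).map φ) :=
  (vertical P).Q_inverts φ (vertical_of_isHomLift P φ h)

/-- A choice of a cocartesian lift at every object `x`, for every morphism `f : P.obj x ⟶ b`. -/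
structure Cleavage where
  obj {x : X} {b : B} (f : P.obj x ⟶ b) : X
  lift {x : X} {b : B} (f : P.obj x ⟶ b) : x ⟶ obj f
  cocartesian {x : X} {b : B} (f : P.obj x ⟶ b) : P.IsStronglyCocartesian f (lift f)

attribute [instance] Cleavage.cocartesian

variable {P}

lemma IsOpfibration.nonempty_cleavage (hP : IsOpfibration P) : Nonempty (Cleavage P) := by
  choose o l h using hP
  exact ⟨⟨fun {x b} f => o f, fun f => l f, fun f => h f⟩⟩

namespace Cleavage

variable (K : Cleavage P)

/-- The vertical comparison `(P φ ≫ f)_* x ⟶ f_* y` induced by `φ : x ⟶ y`. -/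
noncomputable def comparison {x y : X} (φ : x ⟶ y) {b : B} (f : P.obj y ⟶ b) :
    K.obj (P.map φ ≫ f) ⟶ K.obj f :=
  IsStronglyCocartesian.map P (P.map φ ≫ f) (K.lift (P.map φ ≫ f)) (g := 𝟙 b)
    (f' := P.map φ ≫ f) (Category.comp_id _).symm (φ ≫ K.lift f)

instance {x y : X} (φ : x ⟶ y) {b : B} (f : P.obj y ⟶ b) :
    P.IsHomLift (𝟙 b) (K.comparison φ f) := by
  unfold comparison; infer_instance

@[simp]
lemma lift_comparison {x y : X} (φ : x ⟶ y) {b : B} (f : P.obj y ⟶ b) :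
    K.lift (P.map φ ≫ f) ≫ K.comparison φ f = φ ≫ K.lift f := by
  simp [comparison]

@[simp]
lemma lift_comparison_assoc {x y z : X} (φ : x ⟶ y) {b : B} (f : P.obj y ⟶ b) (g : K.obj f ⟶ z) :
    K.lift (P.map φ ≫ f) ≫ K.comparison φ f ≫ g = φ ≫ K.lift f ≫ g := by
  rw [← Category.assoc, lift_comparison, Category.assoc]

instance {x y : X} (φ : x ⟶ y) {b : B} (f : P.obj y ⟶ b) :
    IsIso ((toFractions P).map (K.comparison φ f)) :=
  isIso_toFractions_map P (b := b) _

lemma hom_ext {x z : X} {b : B} {f : P.obj x ⟶ b} {α β : K.obj f ⟶ z} [P.IsHomLift (𝟙 b) α]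
    [P.IsHomLift (𝟙 b) β] (h : K.lift f ≫ α = K.lift f ≫ β) : α = β :=
  IsStronglyCocartesian.ext P f (K.lift f) (𝟙 b) h

/-- The identification of the pushforwards along two equal morphisms. -/
def reindex {x : X} {b : B} {f f' : P.obj x ⟶ b} (h : f = f') : K.obj f ⟶ K.obj f' :=
  eqToHom (congr_arg K.obj h)

@[simp]
lemma lift_reindex {x : X} {b : B} {f f' : P.obj x ⟶ b} (h : f = f') :
    K.lift f ≫ K.reindex h = K.lift f' := by
  subst h; simp [reindex]

@[simp]
lemma lift_reindex_assoc {x z : X} {b : B} {f f' : P.obj x ⟶ b} (h : f = f')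
    (g : K.obj f' ⟶ z) : K.lift f ≫ K.reindex h ≫ g = K.lift f' ≫ g := by
  rw [← Category.assoc, lift_reindex]

instance {x : X} {b : B} {f f' : P.obj x ⟶ b} (h : f = f') : P.IsHomLift (𝟙 b) (K.reindex h) :=
  IsHomLift.eqToHom_domain_lift_id _ (IsHomLift.codomain_eq P f (K.lift f))

/-- A normal form for a morphism from (the image of) `x` to (the image of) `y` in the category
of fractions: a morphism `f` in the base and a vertical morphism `f_* x ⟶ y`. -/
@[ext]
structure NormalForm (y x : X) where
  base : P.obj x ⟶ P.obj y
  hom : (toFractions P).obj (K.obj base) ⟶ (toFractions P).obj y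
  isHomLift : (fractionsFunctor P).IsHomLift (𝟙 (P.obj y)) hom

namespace NormalForm

attribute [instance] NormalForm.isHomLift

variable {K} {y : X}

/-- The morphism represented by a normal form. -/
noncomputable def eval {x : X} (e : NormalForm K y x) :
    (toFractions P).obj x ⟶ (toFractions P).obj y :=
  (toFractions P).map (K.lift e.base) ≫ e.hom

instance {x : X} (e : NormalForm K y x) : (fractionsFunctor P).IsHomLift e.base e.eval := by
  unfold eval; infer_instance

/-- The action of a morphism `φ : x ⟶ x'` of `X` on normal forms, by precomposition with the
vertical comparison `(P φ ≫ f)_* x ⟶ f_* x'`. -/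
noncomputable def precomp {x x' : X} (φ : x ⟶ x') (e : NormalForm K y x') : NormalForm K y x where
  base := P.map φ ≫ e.base
  hom := (toFractions P).map (K.comparison φ e.base) ≫ e.hom
  isHomLift := inferInstance

lemma eval_precomp {x x' : X} (φ : x ⟶ x') (e : NormalForm K y x') :
    (e.precomp φ).eval = (toFractions P).map φ ≫ e.eval := by
  simp only [eval, precomp, ← Functor.map_comp_assoc]
  rw [lift_comparison]

lemma ext_of_reindex {x : X} {e e' : NormalForm K y x} (h : e.base = e'.base)
    (he : e.hom = (toFractions P).map (K.reindex h) ≫ e'.hom) : e = e' := by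
  obtain ⟨f, α, hα⟩ := e
  obtain ⟨f', α', hα'⟩ := e'
  obtain rfl : f = f' := h
  replace he := he.trans ((congr_arg (· ≫ α') ((toFractions P).map_id _)).trans
    (Category.id_comp _))
  exact NormalForm.ext rfl (heq_of_eq he)

lemma precomp_id {x : X} (e : NormalForm K y x) : e.precomp (𝟙 x) = e := by
  have h : P.map (𝟙 x) ≫ e.base = e.base := by simp
  have hc : K.comparison (𝟙 x) e.base = K.reindex h := K.hom_ext (by simp)
  refine ext_of_reindex h ?_
  exact congr_arg (fun c => (toFractions P).map c ≫ e.hom) hc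

lemma precomp_comp {x x' x'' : X} (φ : x ⟶ x') (ψ : x' ⟶ x'') (e : NormalForm K y x'') :
    e.precomp (φ ≫ ψ) = (e.precomp ψ).precomp φ := by
  have h : P.map (φ ≫ ψ) ≫ e.base = P.map φ ≫ P.map ψ ≫ e.base := by simp
  have hc : K.comparison (φ ≫ ψ) e.base =
      K.reindex h ≫ K.comparison φ (P.map ψ ≫ e.base) ≫ K.comparison ψ e.base :=
    K.hom_ext (by simp)
  refine ext_of_reindex h ?_
  dsimp only [precomp]
  rw [hc]
  simp only [Functor.map_comp, Category.assoc]

/-- Since comparisons become invertible in the category of fractions, precomposition can be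
cancelled among normal forms with a given base. -/
lemma precomp_injective {x x' : X} (φ : x ⟶ x') {e e' : NormalForm K y x'}
    (hb : e.base = e'.base) (h : e.precomp φ = e'.precomp φ) : e = e' := by
  obtain ⟨f, α, hα⟩ := e
  obtain ⟨f', α', hα'⟩ := e'
  obtain rfl : f = f' := hb
  simp only [precomp, NormalForm.mk.injEq, heq_eq_eq, true_and] at h
  exact NormalForm.ext rfl (heq_of_eq ((cancel_epi _).1 h))

lemma exists_eq_precomp {x x' : X} (φ : x ⟶ x') (g : P.obj x' ⟶ P.obj y) (e : NormalForm K y x)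
    (h : e.base = P.map φ ≫ g) : ∃ e' : NormalForm K y x', e'.base = g ∧ e'.precomp φ = e := by
  obtain ⟨f, α, hα⟩ := e
  obtain rfl : f = _ := h
  exact ⟨⟨g, inv ((toFractions P).map (K.comparison φ g)) ≫ α, inferInstance⟩, rfl,
    by simp [precomp]⟩

lemma precomp_bijective {x x' : X} (φ : x ⟶ x') (hφ : vertical P φ) :
    Function.Bijective (precomp (K := K) (y := y) φ) := by
  have : IsIso (P.map φ) := vertical_isInvertedBy P φ hφ
  constructor
  · intro e e' h
    refine precomp_injective φ ?_ h
    exact (cancel_epi (P.map φ)).1 (congr_arg base h)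
  · intro e
    obtain ⟨e', -, h⟩ := exists_eq_precomp φ (inv (P.map φ) ≫ e.base) e (by simp)
    exact ⟨e', h⟩

variable (K y) in
/-- Normal forms as a presheaf, in covariant form. -/
noncomputable def functor : X ⥤ (Type (max u₁ v₁ v₂))ᵒᵖ where
  obj x := .op (NormalForm K y x)
  map φ := (TypeCat.ofHom (precomp φ)).op
  map_id _ := Quiver.Hom.unop_inj (TypeCat.Hom.ext (TypeCat.Fun.ext (funext precomp_id)))
  map_comp φ ψ :=
    Quiver.Hom.unop_inj (TypeCat.Hom.ext (TypeCat.Fun.ext (funext (precomp_comp φ ψ))))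

variable (K y) in
lemma functor_inverts : (vertical P).IsInvertedBy (functor K y) := fun x x' φ hφ => by
  have : IsIso (TypeCat.ofHom (precomp (K := K) (y := y) φ)) :=
    (isIso_iff_bijective _).2 (precomp_bijective φ hφ)
  exact inferInstanceAs (IsIso (TypeCat.ofHom (precomp (K := K) (y := y) φ)).op)

variable (K y) in
/-- Precomposition of normal forms by arbitrary morphisms of the category of fractions; it exists
because precomposition by a vertical morphism is bijective. -/
noncomputable def fractionsPrecompFunctor : Fractions P ⥤ (Type (max u₁ v₁ v₂))ᵒᵖ :=
  Localization.Construction.lift (NormalForm.functor K y) (functor_inverts K y)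

/-- Precomposition of a normal form by a morphism of the category of fractions. -/
noncomputable def fractionsPrecomp {x x' : X} (u : (toFractions P).obj x ⟶ (toFractions P).obj x')
    (e : NormalForm K y x') : NormalForm K y x :=
  ((fractionsPrecompFunctor K y).map u).unop e

lemma fractionsPrecomp_map {x x' : X} (φ : x ⟶ x') (e : NormalForm K y x') :
    fractionsPrecomp ((toFractions P).map φ) e = e.precomp φ := by
  have h : (fractionsPrecompFunctor K y).map ((toFractions P).map φ) =
      (NormalForm.functor K y).map φ :=
    (Functor.congr_hom (Localization.Construction.fac _ (functor_inverts K y)) φ).trans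
      ((Category.id_comp _).trans (Category.comp_id _))
  exact congr_arg (fun t => t.unop e) h

lemma fractionsPrecomp_comp {x x' x'' : X} (u : (toFractions P).obj x ⟶ (toFractions P).obj x')
    (v : (toFractions P).obj x' ⟶ (toFractions P).obj x'') (e : NormalForm K y x'') :
    fractionsPrecomp (u ≫ v) e = fractionsPrecomp u (fractionsPrecomp v e) :=
  congr_arg (fun t => t.unop e) ((fractionsPrecompFunctor K y).map_comp u v)

/-- Evaluation is natural with respect to all morphisms of the category of fractions. For the
formal inverse of a vertical `φ` this holds because every normal form is of the form
`e.precomp φ`. -/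
lemma eval_fractionsPrecomp {x x' : X} (u : (toFractions P).obj x ⟶ (toFractions P).obj x')
    (e : NormalForm K y x') : (fractionsPrecomp u e).eval = u ≫ e.eval := by
  let S : MorphismProperty (Fractions P) := fun x x' (u : (toFractions P).obj x.as.obj ⟶
    (toFractions P).obj x'.as.obj) => ∀ e : NormalForm K y x'.as.obj,
      (fractionsPrecomp u e).eval = u ≫ e.eval
  have : S.IsStableUnderComposition := ⟨fun u v hu hv e => by
    refine (congr_arg eval (fractionsPrecomp_comp u v e)).trans ?_
    refine (hu _).trans ?_
    exact (congr_arg (u ≫ ·) (hv e)).trans (Category.assoc u v _).symm⟩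
  have hS : S = ⊤ := by
    refine Localization.Construction.morphismProperty_eq_top S (fun x x' φ e => ?_)
      (fun x x' φ hφ e => ?_)
    · exact (congr_arg eval (fractionsPrecomp_map φ e)).trans (eval_precomp φ e)
    · obtain ⟨e, rfl⟩ := (precomp_bijective φ hφ).2 e
      have h : fractionsPrecomp (Localization.Construction.wInv φ hφ) (e.precomp φ) = e := by
        rw [← fractionsPrecomp_map, ← fractionsPrecomp_comp]
        refine (congr_arg (fun u => fractionsPrecomp u e)
          (Localization.Construction.wIso φ hφ).inv_hom_id).trans ?_
        exact congr_arg (fun t => t.unop e)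
          ((fractionsPrecompFunctor K y).map_id ((toFractions P).obj x'))
      refine (congr_arg eval h).trans ?_
      refine Eq.trans ?_ (congr_arg (Localization.Construction.wInv φ hφ ≫ ·)
        (eval_precomp φ e)).symm
      exact ((Localization.Construction.wIso φ hφ).inv_hom_id_assoc _).symm
  have h : S u := hS ▸ trivial
  exact h e

variable (K y) in
/-- The normal form of an identity: the lift of an identity is vertical, hence invertible in the
category of fractions. -/
noncomputable def ofId : NormalForm K y y where
  base := 𝟙 _
  hom := letI := isIso_toFractions_map P (b := P.obj y) (K.lift (𝟙 (P.obj y)))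
    inv ((toFractions P).map (K.lift (𝟙 (P.obj y))))
  isHomLift := by
    have := isIso_toFractions_map P (b := P.obj y) (K.lift (𝟙 (P.obj y)))
    infer_instance

lemma eval_ofId : (ofId K y).eval = 𝟙 _ := by
  have := isIso_toFractions_map P (b := P.obj y) (K.lift (𝟙 (P.obj y)))
  simp [ofId, eval]

variable (K) in
/-- The normal form of a morphism of the category of fractions. -/
noncomputable def ofHom {x : X} (u : (toFractions P).obj x ⟶ (toFractions P).obj y) :
    NormalForm K y x :=
  fractionsPrecomp u (ofId K y)

lemma eval_ofHom {x : X} (u : (toFractions P).obj x ⟶ (toFractions P).obj y) :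
    (ofHom K u).eval = u := by
  rw [ofHom, eval_fractionsPrecomp, eval_ofId, Category.comp_id]

lemma ofHom_base {x : X} (u : (toFractions P).obj x ⟶ (toFractions P).obj y)
    (f : P.obj x ⟶ P.obj y) [(fractionsFunctor P).IsHomLift f u] : (ofHom K u).base = f := by
  have h : (fractionsFunctor P).IsHomLift (ofHom K u).base u := by
    have : (fractionsFunctor P).IsHomLift (ofHom K u).base (ofHom K u).eval := inferInstance
    rwa [eval_ofHom] at this
  exact isHomLift_unique (fractionsFunctor P) u _ _

lemma ofHom_map_comp {x x' : X} (φ : x ⟶ x')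
    (u : (toFractions P).obj x' ⟶ (toFractions P).obj y) :
    ofHom K ((toFractions P).map φ ≫ u) = (ofHom K u).precomp φ := by
  rw [ofHom, fractionsPrecomp_comp, fractionsPrecomp_map, ofHom]

end NormalForm
end Cleavage

/-- Every morphism of `X` becomes cocartesian in the category of fractions. -/
lemma IsOpfibration.isStronglyCocartesian_toFractions_map (hP : IsOpfibration P) {x x' : X}
    (φ : x ⟶ x') :
    (fractionsFunctor P).IsStronglyCocartesian (P.map φ) ((toFractions P).map φ) where
  universal_property' {y} g u hu := by
    obtain ⟨K⟩ := hP.nonempty_cleavage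
    -- Every object of the category of fractions is, by definition, the image of an object of `X`.
    let y' : X := y.as.obj
    change P.obj x' ⟶ P.obj y' at g
    change (toFractions P).obj x ⟶ (toFractions P).obj y' at u
    change ∃! v : (toFractions P).obj x' ⟶ (toFractions P).obj y',
      (fractionsFunctor P).IsHomLift g v ∧ (toFractions P).map φ ≫ v = u
    have hu' : (fractionsFunctor P).IsHomLift (P.map φ ≫ g) u := hu
    obtain ⟨e, he, he'⟩ := Cleavage.NormalForm.exists_eq_precomp φ g
      (Cleavage.NormalForm.ofHom K u) (Cleavage.NormalForm.ofHom_base u _)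
    have hv : (toFractions P).map φ ≫ e.eval = u := by
      rw [← Cleavage.NormalForm.eval_precomp, he', Cleavage.NormalForm.eval_ofHom]
    refine ⟨e.eval, ⟨he ▸ inferInstance, hv⟩, fun v ⟨hv₁, hv₂⟩ => ?_⟩
    rw [← Cleavage.NormalForm.eval_ofHom (K := K) v]
    congr 1
    refine Cleavage.NormalForm.precomp_injective φ
      ((Cleavage.NormalForm.ofHom_base v g).trans he.symm) ?_
    rw [← Cleavage.NormalForm.ofHom_map_comp, hv₂, he']

/-- Every morphism of the category of fractions is cocartesian: those coming from `X` are, and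
so are the isomorphisms. -/
lemma IsOpfibration.allCocartesian_fractionsFunctor (hP : IsOpfibration P) :
    AllCocartesian (fractionsFunctor P) := by
  intro x y u
  let S : MorphismProperty (Fractions P) := fun x y u =>
    (fractionsFunctor P).IsStronglyCocartesian ((fractionsFunctor P).map u) u
  have : S.IsStableUnderComposition := ⟨fun u v hu hv => by
    change (fractionsFunctor P).IsStronglyCocartesian _ _ at hu hv ⊢
    rw [Functor.map_comp]
    infer_instance⟩
  have hS : S = ⊤ := by
    refine Localization.Construction.morphismProperty_eq_top S (fun x x' φ => ?_)
      (fun x x' φ hφ => ?_)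
    · change (fractionsFunctor P).IsStronglyCocartesian _ _
      rw [fractionsFunctor_map]
      exact hP.isStronglyCocartesian_toFractions_map φ
    · change (fractionsFunctor P).IsStronglyCocartesian _ _
      infer_instance
  have h : S u := hS ▸ trivial
  exact h

/-- The functor induced on the category of fractions is an opfibration. -/
lemma IsOpfibration.isOpfibration_fractionsFunctor (hP : IsOpfibration P) :
    IsOpfibration (fractionsFunctor P) := by
  intro x b f
  obtain ⟨x, rfl⟩ := (Localization.Construction.objEquiv (vertical P)).surjective x
  change P.obj x ⟶ b at f
  obtain ⟨y, φ, h⟩ := hP f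
  obtain rfl := IsHomLift.codomain_eq P f φ
  obtain rfl := IsHomLift.eq_of_isHomLift P f φ
  exact ⟨(toFractions P).obj y, (toFractions P).map φ,
    hP.isStronglyCocartesian_toFractions_map φ⟩

end Cocartesian

/-! ### Finite products in the category of fractions -/

section Products

variable {X : Type u₁} [Category.{v₁} X] {B : Type u₂} [Category.{v₂} B] {P : X ⥤ B}

/-- The quotient functor also inverts the morphisms lying over isomorphisms: such a morphism is
a cocartesian lift of an isomorphism followed by a vertical morphism. -/
lemma IsOpfibration.isIso_toFractions_map (hP : IsOpfibration P) {x y : X} (φ : x ⟶ y)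
    [IsIso (P.map φ)] : IsIso ((toFractions P).map φ) :=
  have := hP.isStronglyCocartesian_toFractions_map φ
  IsStronglyCocartesian.isIso_of_base_isIso (fractionsFunctor P) (P.map φ) _

/-- The category of fractions is also the localization at the morphisms lying over
isomorphisms; unlike the vertical morphisms, these are stable under isomorphism. -/
lemma IsOpfibration.isLocalization_toFractions (hP : IsOpfibration P) :
    (toFractions P).IsLocalization ((MorphismProperty.isomorphisms B).inverseImage P) := by
  have hle : vertical P ≤ (MorphismProperty.isomorphisms B).inverseImage P :=
    fun _ _ φ hφ => vertical_isInvertedBy P φ hφ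
  have univ (E : Type _) [Category E] : Localization.StrictUniversalPropertyFixedTarget
      (toFractions P) ((MorphismProperty.isomorphisms B).inverseImage P) E :=
    { inverts := fun _ _ φ (hφ : IsIso (P.map φ)) => hP.isIso_toFractions_map φ
      lift := fun F hF => Localization.Construction.lift F fun _ _ φ hφ => hF φ (hle _ hφ)
      fac := fun F hF => Localization.Construction.fac F _
      uniq := Localization.Construction.uniq }
  exact .mk' _ _ (univ _) (univ _)

variable [CartesianMonoidalCategory X]

open Limits in
/-- The finite products of the category of fractions, chosen to be the images of those of `X`. -/
noncomputable abbrev fractionsCartesianMonoidalCategory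
    (h : PreservesFiniteProducts (toFractions P)) : CartesianMonoidalCategory (Fractions P) :=
  .ofChosenFiniteProducts
    ⟨asEmptyCone ((toFractions P).obj (𝟙_ X)),
      IsTerminal.isTerminalObj (toFractions P) _ isTerminalTensorUnit⟩
    (fun x y => ⟨BinaryFan.mk ((toFractions P).map (fst x.as.obj y.as.obj))
        ((toFractions P).map (snd x.as.obj y.as.obj)),
      mapIsLimitOfPreservesOfIsLimit (toFractions P) _ _
        (tensorProductIsBinaryProduct x.as.obj y.as.obj)⟩)

lemma strictlyPreservesFiniteProducts_toFractions
    (h : Limits.PreservesFiniteProducts (toFractions P)) :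
    letI := fractionsCartesianMonoidalCategory h
    StrictlyPreservesFiniteProducts (toFractions P) :=
  letI := fractionsCartesianMonoidalCategory h
  { obj_unit := rfl
    obj_tensor := fun _ _ => rfl
    map_fst := fun _ _ => (Category.id_comp _).symm
    map_snd := fun _ _ => (Category.id_comp _).symm }

variable [CartesianMonoidalCategory B]

lemma StrictlyPreservesFiniteProducts.preservesFiniteProducts
    (hprod : StrictlyPreservesFiniteProducts P) : Limits.PreservesFiniteProducts P := by
  have h₁ : IsIso (terminalComparison P) := by
    have : terminalComparison P = eqToHom hprod.obj_unit := toUnit_unique _ _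
    rw [this]; infer_instance
  have h₂ : ∀ x y, IsIso (prodComparison P x y) := fun x y => by
    have : prodComparison P x y = eqToHom (hprod.obj_tensor x y) := by
      ext
      · simp [hprod.map_fst]
      · simp [hprod.map_snd]
    rw [this]; infer_instance
  have := preservesLimit_empty_of_isIso_terminalComparison P
  have := preservesLimitsOfShape_discrete_walkingPair_of_isIso_prodComparison P
  have := Limits.preservesLimitsOfShape_pempty_of_preservesTerminal P
  exact .of_preserves_binary_and_terminal P

open Limits in
/-- The category of fractions has finite products, computed as in `X`: a product-preserving
functor makes the class of morphisms lying over isomorphisms stable under finite products. -/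
lemma preservesFiniteProducts_toFractions (hP : IsOpfibration P)
    (hprod : StrictlyPreservesFiniteProducts P) : PreservesFiniteProducts (toFractions P) := by
  have := hprod.preservesFiniteProducts
  have := hP.isLocalization_toFractions
  let W := (MorphismProperty.isomorphisms B).inverseImage P
  have : W.IsStableUnderFiniteProducts :=
    { isStableUnderProductsOfShape := fun J _ =>
        { condition := fun F G c d hc hd f hf α hα => by
            have hf' (j) : IsIso (P.map (f.app j)) := hf j
            let e : F ⋙ P ≅ G ⋙ P := NatIso.ofComponents (fun j => asIso (P.map (f.app j)))
              (fun g => by simpa [-NatTrans.naturality] using congr_arg P.map (f.naturality g))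
            have he : P.map α = (IsLimit.conePointsIsoOfNatIso (isLimitOfPreserves P hc)
                (isLimitOfPreserves P hd) e).hom :=
              (isLimitOfPreserves P hd).hom_ext fun j => by
                rw [IsLimit.conePointsIsoOfNatIso_hom_comp]
                simpa [e] using congr_arg P.map (hα j)
            change IsIso (P.map α)
            rw [he]
            infer_instance } }
  exact Localization.preservesFiniteProducts (toFractions P) W

lemma strictlyPreservesFiniteProducts_fractionsFunctor
    (h : Limits.PreservesFiniteProducts (toFractions P))
    (hprod : StrictlyPreservesFiniteProducts P) :
    letI := fractionsCartesianMonoidalCategory h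
    StrictlyPreservesFiniteProducts (fractionsFunctor P) :=
  letI := fractionsCartesianMonoidalCategory h
  { obj_unit := hprod.obj_unit
    obj_tensor := fun x y => hprod.obj_tensor x.as.obj y.as.obj
    map_fst := fun x y => (fractionsFunctor_map P _).trans (hprod.map_fst x.as.obj y.as.obj)
    map_snd := fun x y => (fractionsFunctor_map P _).trans (hprod.map_snd x.as.obj y.as.obj) }

end Products

/-! ### Opfibrations all of whose morphisms are cocartesian -/

section Fibres

variable {E : Type u₁} [Category.{v₁} E] {B : Type u₂} [Category.{v₂} B] {p : E ⥤ B}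

lemma fiber_comp_val {b : B} {x y z : Fiber p b} (φ : x ⟶ y) (ψ : y ⟶ z) :
    (φ ≫ ψ).1 = φ.1 ≫ ψ.1 := rfl

lemma fiber_id_val {b : B} (x : Fiber p b) : (𝟙 x : x ⟶ x).1 = 𝟙 x.1 := rfl

namespace AllCocartesian

lemma isStronglyCocartesian (hp : AllCocartesian p) {a b : B} (f : a ⟶ b) {x y : E} (u : x ⟶ y)
    [p.IsHomLift f u] : p.IsStronglyCocartesian f u := by
  subst_hom_lift p f u
  exact hp u

lemma hasGroupoidalFibres (hp : AllCocartesian p) : HasGroupoidalFibres p := fun b =>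
  { all_isIso := fun {x y} φ => by
      have := φ.2
      have := hp.isStronglyCocartesian (𝟙 b) φ.1
      have := IsStronglyCocartesian.isIso_of_base_isIso p (𝟙 b) φ.1
      exact ⟨⟨inv φ.1, inferInstance⟩, Subtype.ext (IsIso.hom_inv_id φ.1),
        Subtype.ext (IsIso.inv_hom_id φ.1)⟩ }

/-- An equality of morphisms of a fibre can be tested after precomposition with any morphism
of `E`. -/
lemma fiber_hom_ext (hp : AllCocartesian p) {b : B} {w : E} {x y : Fiber p b} (u : w ⟶ x.1)
    {φ ψ : x ⟶ y} (h : u ≫ φ.1 = u ≫ ψ.1) : φ = ψ := by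
  obtain ⟨x, rfl⟩ := x
  have := φ.2
  have := ψ.2
  have := hp u
  exact Subtype.ext (IsStronglyCocartesian.ext p (p.map u) u (𝟙 (p.obj x)) h)

/-- Two morphisms with the same domain, lying over the same morphism, have canonically isomorphic
codomains. -/
lemma exists_fiber_iso (hp : AllCocartesian p) {a b : B} {w : E} {x y : Fiber p b} (f : a ⟶ b)
    (u : w ⟶ x.1) (v : w ⟶ y.1) [hu : p.IsHomLift f u]
    [hv : p.IsHomLift f v] : ∃ e : x ≅ y, u ≫ e.hom.1 = v := by
  have := hp.isStronglyCocartesian f u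
  have := hp.hasGroupoidalFibres b
  obtain ⟨χ, ⟨h₁, h₂⟩, -⟩ := IsStronglyCocartesian.universal_property p f u (𝟙 b) f (by simp) v
  let φ : x ⟶ y := ⟨χ, h₁⟩
  exact ⟨asIso φ, h₂⟩

end AllCocartesian

lemma IsOpfibration.exists_lift (h : IsOpfibration p) {a b : B} (x : E) (hx : p.obj x = a)
    (f : a ⟶ b) : ∃ (y : Fiber p b) (u : x ⟶ y.1), p.IsHomLift f u := by
  subst hx
  obtain ⟨y, u, hu⟩ := h f
  exact ⟨⟨y, IsHomLift.codomain_eq p f u⟩, u, inferInstance⟩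

end Fibres

section Strict

variable {E : Type u₁} [Category.{v₁} E] {B : Type u₂} [Category.{v₂} B] {p : E ⥤ B}
  [CartesianMonoidalCategory E] [CartesianMonoidalCategory B]

namespace StrictlyPreservesFiniteProducts

variable (h : StrictlyPreservesFiniteProducts p)
include h

lemma obj_tensor_of_eq {x y : E} {a b : B} (hx : p.obj x = a) (hy : p.obj y = b) :
    p.obj (x ⊗ y) = a ⊗ b := by
  rw [h.obj_tensor, hx, hy]

lemma isHomLift_fst {x y : E} {a b : B} (hx : p.obj x = a) (hy : p.obj y = b) :
    p.IsHomLift (fst a b) (fst x y) := by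
  subst hx hy
  exact IsHomLift.of_fac' p _ _ (h.obj_tensor x y) rfl (by simpa using h.map_fst x y)

lemma isHomLift_snd {x y : E} {a b : B} (hx : p.obj x = a) (hy : p.obj y = b) :
    p.IsHomLift (snd a b) (snd x y) := by
  subst hx hy
  exact IsHomLift.of_fac' p _ _ (h.obj_tensor x y) rfl (by simpa using h.map_snd x y)

lemma isHomLift_toUnit {x : E} {a : B} (hx : p.obj x = a) :
    p.IsHomLift (toUnit a) (toUnit x) :=
  IsHomLift.of_fac' p _ _ hx h.obj_unit ((cancel_mono (eqToHom h.obj_unit)).1 (toUnit_unique _ _))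

lemma isHomLift_iff {w x y : E} {c a b : B} (hx : p.obj x = a) (hy : p.obj y = b)
    (f : c ⟶ a ⊗ b) (u : w ⟶ x ⊗ y) :
    p.IsHomLift f u ↔
      p.IsHomLift (f ≫ fst a b) (u ≫ fst x y) ∧ p.IsHomLift (f ≫ snd a b) (u ≫ snd x y) := by
  have := h.isHomLift_fst hx hy
  have := h.isHomLift_snd hx hy
  refine ⟨fun _ => ⟨inferInstance, inferInstance⟩, fun ⟨h₁, h₂⟩ => ?_⟩
  obtain rfl := IsHomLift.domain_eq p (f ≫ fst a b) (u ≫ fst x y)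
  have hxy := h.obj_tensor_of_eq hx hy
  have hu : p.IsHomLift (p.map u ≫ eqToHom hxy) u := inferInstance
  have : p.map u ≫ eqToHom hxy = f := by
    ext
    · exact isHomLift_unique p (u ≫ fst x y) _ _
    · exact isHomLift_unique p (u ≫ snd x y) _ _
  rwa [← this]

lemma isHomLift_lift {w x y : E} {c a b : B} (f : c ⟶ a) (g : c ⟶ b)
    (u : w ⟶ x) (v : w ⟶ y) [hu : p.IsHomLift f u] [hv : p.IsHomLift g v] :
    p.IsHomLift (lift f g) (lift u v) := by
  rw [h.isHomLift_iff (IsHomLift.codomain_eq p f u) (IsHomLift.codomain_eq p g v)]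
  simpa using ⟨hu, hv⟩

end StrictlyPreservesFiniteProducts
end Strict

/-! ### Adding objects of a fibre -/

section FibreSum

variable {E : Type u₁} [Category.{v₁} E] {B : Type u₂} [Category.{v₂} B]
  [CartesianMonoidalCategory E] [CartesianMonoidalCategory B] [Preadditive B]

/-- Lifts `μ` of the addition and `ε` of the zero of `b`, at all objects of the fibre over `b`. -/
structure FiberSum (p : E ⥤ B) (b : B) where
  obj : Fiber p b → Fiber p b → Fiber p b
  μ (x y : Fiber p b) : x.1 ⊗ y.1 ⟶ (obj x y).1
  isHomLift_μ (x y : Fiber p b) : p.IsHomLift (fst b b + snd b b) (μ x y)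
  unit : Fiber p b
  ε : 𝟙_ E ⟶ unit.1
  isHomLift_ε : p.IsHomLift (0 : 𝟙_ B ⟶ b) ε

attribute [instance] FiberSum.isHomLift_μ FiberSum.isHomLift_ε

variable {p : E ⥤ B} {b : B}

variable (b) in
lemma IsOpfibration.nonempty_fiberSum (h : IsOpfibration p)
    (hs : StrictlyPreservesFiniteProducts p) : Nonempty (FiberSum p b) := by
  obtain ⟨I, ε, hε⟩ := h.exists_lift (𝟙_ E) hs.obj_unit (0 : 𝟙_ B ⟶ b)
  choose o μ hμ using fun x y : Fiber p b =>
    h.exists_lift (x.1 ⊗ y.1) (hs.obj_tensor_of_eq x.2 y.2) (fst b b + snd b b)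
  exact ⟨⟨o, μ, hμ, I, ε, hε⟩⟩

namespace FiberSum

variable (S : FiberSum p b) {w w' : E} {x y z x' y' : Fiber p b}

/-- The sum of two generalized elements of objects of the fibre. -/
def add (u : w ⟶ x.1) (v : w ⟶ y.1) : w ⟶ (S.obj x y).1 := lift u v ≫ S.μ x y

/-- The zero generalized element. -/
def zero (w : E) : w ⟶ S.unit.1 := toUnit w ≫ S.ε

lemma comp_add (g : w' ⟶ w) (u : w ⟶ x.1) (v : w ⟶ y.1) :
    g ≫ S.add u v = S.add (g ≫ u) (g ≫ v) := by
  simp [add, comp_lift_assoc]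

lemma comp_zero (g : w' ⟶ w) : g ≫ S.zero w = S.zero w' := by
  simp [zero]

lemma comp_μ (g : w ⟶ x.1 ⊗ y.1) : g ≫ S.μ x y = S.add (g ≫ fst _ _) (g ≫ snd _ _) := by
  simp [add, lift_comp_fst_snd]

lemma isHomLift_add (hs : StrictlyPreservesFiniteProducts p) {c : B} (f g : c ⟶ b)
    (u : w ⟶ x.1) (v : w ⟶ y.1) [p.IsHomLift f u] [p.IsHomLift g v] :
    p.IsHomLift (f + g) (S.add u v) := by
  have := hs.isHomLift_lift f g u v
  have h : p.IsHomLift (lift f g ≫ (fst b b + snd b b)) (S.add u v) := by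
    unfold add; infer_instance
  simpa using h

lemma isHomLift_zero (hs : StrictlyPreservesFiniteProducts p) {c : B} (hw : p.obj w = c) :
    p.IsHomLift (0 : c ⟶ b) (S.zero w) := by
  have := hs.isHomLift_toUnit hw
  have h : p.IsHomLift (toUnit c ≫ (0 : 𝟙_ B ⟶ b)) (S.zero w) := by
    unfold zero; infer_instance
  simpa using h

variable (hp : AllCocartesian p) (hs : StrictlyPreservesFiniteProducts p)
include hp hs

/-- Both sums of generalized elements lie over `fst + snd`, hence their codomains are canonically
isomorphic. The constraints below arise in the same way from the associativity, unit and
commutativity laws of the addition in `B`. -/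
lemma exists_map (φ : x ⟶ x') (ψ : y ⟶ y') : ∃ χ : S.obj x y ⟶ S.obj x' y',
    ∀ {w : E} (u : w ⟶ x.1) (v : w ⟶ y.1), S.add u v ≫ χ.1 = S.add (u ≫ φ.1) (v ≫ ψ.1) := by
  have := φ.2
  have := ψ.2
  have := hs.isHomLift_fst x.2 y.2
  have := hs.isHomLift_snd x.2 y.2
  have := S.isHomLift_add hs (fst b b) (snd b b) (fst x.1 y.1) (snd x.1 y.1)
  have := S.isHomLift_add hs (fst b b) (snd b b) (fst x.1 y.1 ≫ φ.1) (snd x.1 y.1 ≫ ψ.1)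
  obtain ⟨e, he⟩ := hp.exists_fiber_iso (fst b b + snd b b) (S.add (fst x.1 y.1) (snd x.1 y.1))
    (S.add (fst x.1 y.1 ≫ φ.1) (snd x.1 y.1 ≫ ψ.1))
  refine ⟨e.hom, fun u v => ?_⟩
  simpa [reassoc_of% S.comp_add, S.comp_add] using congr_arg (lift u v ≫ ·) he

lemma exists_associator (x y z : Fiber p b) : ∃ e : S.obj (S.obj x y) z ≅ S.obj x (S.obj y z),
    ∀ {w : E} (u : w ⟶ x.1) (v : w ⟶ y.1) (t : w ⟶ z.1),
      S.add (S.add u v) t ≫ e.hom.1 = S.add u (S.add v t) := by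
  have hxy := hs.obj_tensor_of_eq x.2 y.2
  have := hs.isHomLift_fst x.2 y.2
  have := hs.isHomLift_snd x.2 y.2
  have := hs.isHomLift_fst hxy z.2
  have := hs.isHomLift_snd hxy z.2
  let u' : (x.1 ⊗ y.1) ⊗ z.1 ⟶ x.1 := fst _ _ ≫ fst _ _
  let v' : (x.1 ⊗ y.1) ⊗ z.1 ⟶ y.1 := fst _ _ ≫ snd _ _
  let t' : (x.1 ⊗ y.1) ⊗ z.1 ⟶ z.1 := snd _ _
  let f : (b ⊗ b) ⊗ b ⟶ b := fst _ _ ≫ fst _ _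
  let g : (b ⊗ b) ⊗ b ⟶ b := fst _ _ ≫ snd _ _
  let h : (b ⊗ b) ⊗ b ⟶ b := snd _ _
  have : p.IsHomLift f u' := inferInstanceAs (p.IsHomLift (_ ≫ _) (_ ≫ _))
  have : p.IsHomLift g v' := inferInstanceAs (p.IsHomLift (_ ≫ _) (_ ≫ _))
  have : p.IsHomLift h t' := ‹p.IsHomLift (snd (b ⊗ b) b) _›
  have := S.isHomLift_add hs f g u' v'
  have := S.isHomLift_add hs g h v' t'
  have := S.isHomLift_add hs f (g + h) u' (S.add v' t')
  have : p.IsHomLift (f + (g + h)) (S.add (S.add u' v') t') := by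
    rw [← add_assoc]
    exact S.isHomLift_add hs (f + g) h (S.add u' v') t'
  obtain ⟨e, he⟩ := hp.exists_fiber_iso (f + (g + h)) (S.add (S.add u' v') t')
    (S.add u' (S.add v' t'))
  refine ⟨e, fun u v t => ?_⟩
  simpa [reassoc_of% S.comp_add, S.comp_add, u', v', t'] using
    congr_arg (lift (lift u v) t ≫ ·) he

lemma exists_leftUnitor (x : Fiber p b) : ∃ e : S.obj S.unit x ≅ x,
    ∀ {w : E} (u : w ⟶ x.1), S.add (S.zero w) u ≫ e.hom.1 = u := by
  have := IsHomLift.id x.2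
  have := S.isHomLift_zero hs x.2
  have : p.IsHomLift (𝟙 b) (S.add (S.zero x.1) (𝟙 x.1)) := by
    simpa using S.isHomLift_add hs (0 : b ⟶ b) (𝟙 b) (S.zero x.1) (𝟙 x.1)
  obtain ⟨e, he⟩ := hp.exists_fiber_iso (𝟙 b) (S.add (S.zero x.1) (𝟙 x.1)) (𝟙 x.1)
  refine ⟨e, fun u => ?_⟩
  simpa [reassoc_of% S.comp_add, S.comp_zero] using congr_arg (u ≫ ·) he

lemma exists_rightUnitor (x : Fiber p b) : ∃ e : S.obj x S.unit ≅ x,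
    ∀ {w : E} (u : w ⟶ x.1), S.add u (S.zero w) ≫ e.hom.1 = u := by
  have := IsHomLift.id x.2
  have := S.isHomLift_zero hs x.2
  have : p.IsHomLift (𝟙 b) (S.add (𝟙 x.1) (S.zero x.1)) := by
    simpa using S.isHomLift_add hs (𝟙 b) (0 : b ⟶ b) (𝟙 x.1) (S.zero x.1)
  obtain ⟨e, he⟩ := hp.exists_fiber_iso (𝟙 b) (S.add (𝟙 x.1) (S.zero x.1)) (𝟙 x.1)
  refine ⟨e, fun u => ?_⟩
  simpa [reassoc_of% S.comp_add, S.comp_zero] using congr_arg (u ≫ ·) he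

lemma exists_braiding (x y : Fiber p b) : ∃ e : S.obj x y ≅ S.obj y x,
    ∀ {w : E} (u : w ⟶ x.1) (v : w ⟶ y.1), S.add u v ≫ e.hom.1 = S.add v u := by
  have := hs.isHomLift_fst x.2 y.2
  have := hs.isHomLift_snd x.2 y.2
  have := S.isHomLift_add hs (fst b b) (snd b b) (fst x.1 y.1) (snd x.1 y.1)
  have : p.IsHomLift (fst b b + snd b b) (S.add (snd x.1 y.1) (fst x.1 y.1)) := by
    rw [add_comm]
    exact S.isHomLift_add hs (snd b b) (fst b b) (snd x.1 y.1) (fst x.1 y.1)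
  obtain ⟨e, he⟩ := hp.exists_fiber_iso (fst b b + snd b b) (S.add (fst x.1 y.1) (snd x.1 y.1))
    (S.add (snd x.1 y.1) (fst x.1 y.1))
  refine ⟨e, fun u v => ?_⟩
  simpa [reassoc_of% S.comp_add, S.comp_add] using congr_arg (lift u v ≫ ·) he

/-- The tensor product of two morphisms of the fibre. -/
noncomputable def map (φ : x ⟶ x') (ψ : y ⟶ y') : S.obj x y ⟶ S.obj x' y' :=
  (S.exists_map hp hs φ ψ).choose

lemma add_map (φ : x ⟶ x') (ψ : y ⟶ y') (u : w ⟶ x.1) (v : w ⟶ y.1) :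
    S.add u v ≫ (S.map hp hs φ ψ).1 = S.add (u ≫ φ.1) (v ≫ ψ.1) :=
  (S.exists_map hp hs φ ψ).choose_spec u v

variable (x y z) in
/-- The associativity constraint. -/
noncomputable def assoc : S.obj (S.obj x y) z ≅ S.obj x (S.obj y z) :=
  (S.exists_associator hp hs x y z).choose

lemma add_assoc_hom (u : w ⟶ x.1) (v : w ⟶ y.1) (t : w ⟶ z.1) :
    S.add (S.add u v) t ≫ (S.assoc x y z hp hs).hom.1 = S.add u (S.add v t) :=
  (S.exists_associator hp hs x y z).choose_spec u v t

variable (x) in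
/-- The left unit constraint. -/
noncomputable def zeroAdd : S.obj S.unit x ≅ x := (S.exists_leftUnitor hp hs x).choose

lemma add_zeroAdd_hom (u : w ⟶ x.1) :
    S.add (S.zero w) u ≫ (S.zeroAdd x hp hs).hom.1 = u :=
  (S.exists_leftUnitor hp hs x).choose_spec u

variable (x) in
/-- The right unit constraint. -/
noncomputable def addZero : S.obj x S.unit ≅ x := (S.exists_rightUnitor hp hs x).choose

lemma add_addZero_hom (u : w ⟶ x.1) :
    S.add u (S.zero w) ≫ (S.addZero x hp hs).hom.1 = u :=
  (S.exists_rightUnitor hp hs x).choose_spec u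

variable (x y) in
/-- The symmetry. -/
noncomputable def comm : S.obj x y ≅ S.obj y x := (S.exists_braiding hp hs x y).choose

lemma add_comm_hom (u : w ⟶ x.1) (v : w ⟶ y.1) :
    S.add u v ≫ (S.comm x y hp hs).hom.1 = S.add v u :=
  (S.exists_braiding hp hs x y).choose_spec u v

end FiberSum
end FibreSum

/-! ### The symmetric monoidal structure of a fibre -/

section FibreMonoidal

variable {E : Type u₁} [Category.{v₁} E] {B : Type u₂} [Category.{v₂} B]
  [CartesianMonoidalCategory E] [CartesianMonoidalCategory B] [Preadditive B]
  {p : E ⥤ B} {b : B}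

namespace FiberSum

variable (S : FiberSum p b) {w : E} {x y z t : Fiber p b}
  (hp : AllCocartesian p) (hs : StrictlyPreservesFiniteProducts p)

/-- The data of the tensor product on the fibre. -/
noncomputable abbrev monoidalCategoryStruct : MonoidalCategoryStruct (Fiber p b) where
  tensorObj := S.obj
  whiskerLeft x _ _ φ := S.map hp hs (𝟙 x) φ
  whiskerRight φ y := S.map hp hs φ (𝟙 y)
  tensorHom φ ψ := S.map hp hs φ ψ
  tensorUnit := S.unit
  associator x y z := S.assoc x y z hp hs
  leftUnitor x := S.zeroAdd x hp hs
  rightUnitor x := S.addZero x hp hs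

include hp in
/-- Two morphisms agree if they agree on all generalized elements of the form `S.add u v`. -/
lemma hom_ext {φ ψ : S.obj x y ⟶ z} (h : ∀ {w : E} (u : w ⟶ x.1) (v : w ⟶ y.1),
    S.add u v ≫ φ.1 = S.add u v ≫ ψ.1) : φ = ψ :=
  hp.fiber_hom_ext _ (h (fst x.1 y.1) (snd x.1 y.1))

include hp in
lemma hom_ext₃ {φ ψ : S.obj (S.obj x y) z ⟶ t}
    (h : ∀ {w : E} (u : w ⟶ x.1) (v : w ⟶ y.1) (s : w ⟶ z.1),
      S.add (S.add u v) s ≫ φ.1 = S.add (S.add u v) s ≫ ψ.1) : φ = ψ :=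
  hp.fiber_hom_ext _ (h (fst _ _ ≫ fst _ _) (fst _ _ ≫ snd _ _) (snd (x.1 ⊗ y.1) z.1))

include hp in
lemma hom_ext₄ {r : Fiber p b} {φ ψ : S.obj (S.obj (S.obj x y) z) r ⟶ t}
    (h : ∀ {w : E} (u : w ⟶ x.1) (v : w ⟶ y.1) (s : w ⟶ z.1) (k : w ⟶ r.1),
      S.add (S.add (S.add u v) s) k ≫ φ.1 = S.add (S.add (S.add u v) s) k ≫ ψ.1) : φ = ψ :=
  hp.fiber_hom_ext _ (h (fst _ _ ≫ fst _ _ ≫ fst _ _) (fst _ _ ≫ fst _ _ ≫ snd _ _)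
    (fst _ _ ≫ snd _ _) (snd ((x.1 ⊗ y.1) ⊗ z.1) r.1))

/-- The monoidal structure of the fibre: its axioms hold because they hold, as equalities
of generalized elements, for the addition of `b`. -/
noncomputable abbrev monoidalCategory : MonoidalCategory (Fiber p b) :=
  letI := S.monoidalCategoryStruct hp hs
  .ofTensorHom
    (id_tensorHom_id := fun x y => S.hom_ext hp fun u v => by
      change _ ≫ (S.map hp hs _ _).1 = _ ≫ 𝟙 _
      simp only [add_map, fiber_id_val, Category.comp_id])
    (id_tensorHom := fun _ _ _ _ => rfl)
    (tensorHom_id := fun _ _ => rfl)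
    (tensorHom_comp_tensorHom := fun φ₁ φ₂ ψ₁ ψ₂ => S.hom_ext hp fun u v => by
      change _ ≫ (S.map hp hs _ _).1 ≫ (S.map hp hs _ _).1 = _ ≫ (S.map hp hs _ _).1
      simp only [← Category.assoc, add_map, fiber_comp_val])
    (associator_naturality := fun φ₁ φ₂ φ₃ => S.hom_ext₃ hp fun u v s => by
      change _ ≫ (S.map hp hs (S.map hp hs _ _) _).1 ≫ (S.assoc _ _ _ hp hs).hom.1 =
        _ ≫ (S.assoc _ _ _ hp hs).hom.1 ≫ (S.map hp hs _ (S.map hp hs _ _)).1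
      simp only [← Category.assoc, add_map, add_assoc_hom])
    (leftUnitor_naturality := fun φ => hp.fiber_hom_ext (S.add (S.zero _) (𝟙 _)) <| by
      change _ ≫ (S.map hp hs (𝟙 _) _).1 ≫ (S.zeroAdd _ hp hs).hom.1 =
        _ ≫ (S.zeroAdd _ hp hs).hom.1 ≫ _
      simp only [← Category.assoc, add_map, add_zeroAdd_hom, fiber_id_val, Category.comp_id])
    (rightUnitor_naturality := fun φ => hp.fiber_hom_ext (S.add (𝟙 _) (S.zero _)) <| by
      change _ ≫ (S.map hp hs _ (𝟙 _)).1 ≫ (S.addZero _ hp hs).hom.1 =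
        _ ≫ (S.addZero _ hp hs).hom.1 ≫ _
      simp only [← Category.assoc, add_map, add_addZero_hom, fiber_id_val, Category.comp_id])
    (pentagon := fun x y z t => S.hom_ext₄ hp fun u v s k => by
      change _ ≫ (S.map hp hs (S.assoc x y z hp hs).hom (𝟙 t)).1 ≫
        (S.assoc x (S.obj y z) t hp hs).hom.1 ≫
          (S.map hp hs (𝟙 x) (S.assoc y z t hp hs).hom).1 =
        _ ≫ (S.assoc (S.obj x y) z t hp hs).hom.1 ≫ (S.assoc x y (S.obj z t) hp hs).hom.1
      simp only [← Category.assoc, add_map, add_assoc_hom, fiber_id_val, Category.comp_id])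
    (triangle := fun x y => hp.fiber_hom_ext
        (S.add (S.add (fst x.1 y.1) (S.zero _)) (snd x.1 y.1)) <| by
      change _ ≫ (S.assoc x S.unit y hp hs).hom.1 ≫
        (S.map hp hs (𝟙 x) (S.zeroAdd y hp hs).hom).1 =
        _ ≫ (S.map hp hs (S.addZero x hp hs).hom (𝟙 y)).1
      simp only [← Category.assoc, add_map, add_assoc_hom, add_zeroAdd_hom, add_addZero_hom,
        fiber_id_val, Category.comp_id])

/-- The symmetry of the fibre. -/
noncomputable abbrev symmetricCategory :
    letI := S.monoidalCategory hp hs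
    SymmetricCategory (Fiber p b) :=
  letI := S.monoidalCategory hp hs
  { braiding := fun x y => S.comm x y hp hs
    braiding_naturality_right := fun x y z φ => S.hom_ext hp fun u v => by
      change _ ≫ (S.map hp hs _ _).1 ≫ (S.comm _ _ hp hs).hom.1 =
        _ ≫ (S.comm _ _ hp hs).hom.1 ≫ (S.map hp hs _ _).1
      simp only [← Category.assoc, add_map, add_comm_hom]
    braiding_naturality_left := fun φ z => S.hom_ext hp fun u v => by
      change _ ≫ (S.map hp hs _ _).1 ≫ (S.comm _ _ hp hs).hom.1 =
        _ ≫ (S.comm _ _ hp hs).hom.1 ≫ (S.map hp hs _ _).1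
      simp only [← Category.assoc, add_map, add_comm_hom]
    hexagon_forward := fun x y z => S.hom_ext₃ hp fun u v s => by
      change _ ≫ (S.assoc x y z hp hs).hom.1 ≫ (S.comm x (S.obj y z) hp hs).hom.1 ≫
          (S.assoc y z x hp hs).hom.1 =
        _ ≫ (S.map hp hs (S.comm x y hp hs).hom (𝟙 z)).1 ≫ (S.assoc y x z hp hs).hom.1 ≫
          (S.map hp hs (𝟙 y) (S.comm x z hp hs).hom).1
      simp only [← Category.assoc, add_map, add_assoc_hom, add_comm_hom, fiber_id_val,
        Category.comp_id]
    hexagon_reverse := fun x y z => by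
      have h {x y z : Fiber p b} {w : E} (u : w ⟶ x.1) (v : w ⟶ y.1) (s : w ⟶ z.1) :
          S.add u (S.add v s) ≫ (S.assoc x y z hp hs).inv.1 = S.add (S.add u v) s := by
        rw [← S.add_assoc_hom hp hs u v s, Category.assoc, ← fiber_comp_val, Iso.hom_inv_id]
        exact Category.comp_id _
      refine hp.fiber_hom_ext (S.add (fst _ _ ≫ fst _ _) (S.add (fst _ _ ≫ snd _ _)
        (snd (x.1 ⊗ y.1) z.1))) ?_
      change _ ≫ (S.assoc x y z hp hs).inv.1 ≫ (S.comm (S.obj x y) z hp hs).hom.1 ≫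
          (S.assoc z x y hp hs).inv.1 =
        _ ≫ (S.map hp hs (𝟙 x) (S.comm y z hp hs).hom).1 ≫ (S.assoc x z y hp hs).inv.1 ≫
          (S.map hp hs (S.comm x z hp hs).hom (𝟙 y)).1
      simp only [← Category.assoc, add_map, h, add_comm_hom, fiber_id_val, Category.comp_id]
    symmetry := fun x y => S.hom_ext hp fun u v => by
      change _ ≫ (S.comm x y hp hs).hom.1 ≫ (S.comm y x hp hs).hom.1 = _ ≫ 𝟙 _
      simp only [← Category.assoc, add_comm_hom, Category.comp_id] }

/-- The lifts of the addition and of the zero make the inclusion of the fibre a lax symmetric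
monoidal functor. -/
noncomputable abbrev laxBraided [BraidedCategory E] :
    letI := S.monoidalCategory hp hs
    letI := S.symmetricCategory hp hs
    (Fiber.fiberInclusion : Fiber p b ⥤ E).LaxBraided :=
  letI := S.monoidalCategory hp hs
  letI := S.symmetricCategory hp hs
  { ε := S.ε
    μ := S.μ
    μ_natural_left := fun {x y} φ z => by
      change φ.1 ▷ z.1 ≫ S.μ y z = S.μ x z ≫ (S.map hp hs φ (𝟙 z)).1
      rw [← Category.id_comp (S.μ x z), comp_μ, comp_μ, add_map]
      simp [fiber_id_val]
    μ_natural_right := fun {x y} z φ => by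
      change z.1 ◁ φ.1 ≫ S.μ z y = S.μ z x ≫ (S.map hp hs (𝟙 z) φ).1
      rw [← Category.id_comp (S.μ z x), comp_μ, comp_μ, add_map]
      simp [fiber_id_val]
    associativity := fun x y z => by
      change S.μ x y ▷ z.1 ≫ S.μ (S.obj x y) z ≫ (S.assoc x y z hp hs).hom.1 =
        (α_ x.1 y.1 z.1).hom ≫ x.1 ◁ S.μ y z ≫ S.μ x (S.obj y z)
      rw [← Category.assoc, ← Category.assoc, comp_μ, comp_μ]
      simp only [Category.assoc, whiskerRight_fst, whiskerRight_snd, whiskerLeft_fst,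
        whiskerLeft_snd, comp_μ, associator_hom_fst, associator_hom_snd_fst,
        associator_hom_snd_snd, add_assoc_hom, comp_add]
    left_unitality := fun x => by
      change (λ_ x.1).hom = S.ε ▷ x.1 ≫ S.μ S.unit x ≫ (S.zeroAdd x hp hs).hom.1
      rw [← Category.assoc, comp_μ, whiskerRight_fst, whiskerRight_snd,
        toUnit_unique (fst (𝟙_ E) x.1) (toUnit _), leftUnitor_hom]
      exact (S.add_zeroAdd_hom hp hs (snd (𝟙_ E) x.1)).symm
    right_unitality := fun x => by
      change (ρ_ x.1).hom = x.1 ◁ S.ε ≫ S.μ x S.unit ≫ (S.addZero x hp hs).hom.1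
      rw [← Category.assoc, comp_μ, whiskerLeft_fst, whiskerLeft_snd,
        toUnit_unique (snd x.1 (𝟙_ E)) (toUnit _), rightUnitor_hom]
      exact (S.add_addZero_hom hp hs (fst x.1 (𝟙_ E))).symm
    braided := fun x y => by
      change S.μ x y ≫ (S.comm x y hp hs).hom.1 = (β_ x.1 y.1).hom ≫ S.μ y x
      rw [← Category.id_comp (S.μ x y), comp_μ, comp_μ, add_comm_hom]
      simp }

/-- The induced symmetric monoidal structure on the fibre. -/
noncomputable def inducedSymmetricMonoidalStructure [BraidedCategory E] :
    InducedSymmetricMonoidalStructure p b :=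
  letI := S.monoidalCategory hp hs
  letI := S.symmetricCategory hp hs
  letI := S.laxBraided hp hs
  { ε_cocartesian := hp.isStronglyCocartesian (0 : 𝟙_ B ⟶ b) S.ε
    μ_cocartesian := fun x y => hp.isStronglyCocartesian (fst b b + snd b b) (S.μ x y) }

end FiberSum
end FibreMonoidal

/-! ### Generalized elements and lax monoidal functors -/

section LaxAdd

variable {C : Type u₁} [Category.{v₁} C] [MonoidalCategory C] {E : Type u₂} [Category.{v₂} E]
  [CartesianMonoidalCategory E] (F : C ⥤ E) [F.LaxMonoidal] {w w' : E} {x y z x' y' : C}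

/-- The product of two generalized elements, for a lax monoidal functor with values in a
cartesian monoidal category. -/
def laxMul (u : w ⟶ F.obj x) (v : w ⟶ F.obj y) : w ⟶ F.obj (x ⊗ y) :=
  lift u v ≫ LaxMonoidal.μ F x y

/-- The unit generalized element. -/
def laxOne (w : E) : w ⟶ F.obj (𝟙_ C) := toUnit w ≫ LaxMonoidal.ε F

lemma comp_laxMul (g : w' ⟶ w) (u : w ⟶ F.obj x) (v : w ⟶ F.obj y) :
    g ≫ laxMul F u v = laxMul F (g ≫ u) (g ≫ v) := by
  simp [laxMul, comp_lift_assoc]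

lemma comp_laxOne (g : w' ⟶ w) : g ≫ laxOne F w = laxOne F w' := by
  simp [laxOne]

lemma laxMul_map_tensorHom (φ : x ⟶ x') (ψ : y ⟶ y') (u : w ⟶ F.obj x) (v : w ⟶ F.obj y) :
    laxMul F u v ≫ F.map (φ ⊗ₘ ψ) = laxMul F (u ≫ F.map φ) (v ≫ F.map ψ) := by
  simp only [laxMul, Category.assoc, ← LaxMonoidal.μ_natural, lift_map_assoc]

lemma laxMul_map_whiskerRight (φ : x ⟶ x') (u : w ⟶ F.obj x) (v : w ⟶ F.obj y) :
    laxMul F u v ≫ F.map (φ ▷ y) = laxMul F (u ≫ F.map φ) v := by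
  rw [← tensorHom_id, laxMul_map_tensorHom, F.map_id, Category.comp_id]

lemma laxMul_map_whiskerLeft (ψ : y ⟶ y') (u : w ⟶ F.obj x) (v : w ⟶ F.obj y) :
    laxMul F u v ≫ F.map (x ◁ ψ) = laxMul F u (v ≫ F.map ψ) := by
  rw [← id_tensorHom, laxMul_map_tensorHom, F.map_id, Category.comp_id]

lemma laxMul_map_associator (u : w ⟶ F.obj x) (v : w ⟶ F.obj y) (t : w ⟶ F.obj z) :
    laxMul F (laxMul F u v) t ≫ F.map (α_ x y z).hom = laxMul F u (laxMul F v t) := by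
  have h := congr_arg (lift (lift u v) t ≫ ·) (LaxMonoidal.associativity F x y z)
  simpa [laxMul, -LaxMonoidal.associativity] using h

lemma laxMul_map_leftUnitor (u : w ⟶ F.obj x) :
    laxMul F (laxOne F w) u ≫ F.map (λ_ x).hom = u := by
  have h := congr_arg (lift (toUnit w) u ≫ ·) (LaxMonoidal.left_unitality F x)
  simpa [laxMul, laxOne, -LaxMonoidal.left_unitality] using h.symm

lemma laxMul_map_rightUnitor (u : w ⟶ F.obj x) :
    laxMul F u (laxOne F w) ≫ F.map (ρ_ x).hom = u := by
  have h := congr_arg (lift u (toUnit w) ≫ ·) (LaxMonoidal.right_unitality F x)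
  simpa [laxMul, laxOne, -LaxMonoidal.right_unitality] using h.symm

end LaxAdd

section LaxBraided

variable {C : Type u₁} [Category.{v₁} C] [MonoidalCategory C] [BraidedCategory C] {E : Type u₂}
  [Category.{v₂} E] [CartesianMonoidalCategory E] [BraidedCategory E] (F : C ⥤ E) [F.LaxBraided]
  {w : E} {x y : C}

lemma laxMul_map_braiding (u : w ⟶ F.obj x) (v : w ⟶ F.obj y) :
    laxMul F u v ≫ F.map (β_ x y).hom = laxMul F v u := by
  have h := congr_arg (lift u v ≫ ·) (LaxBraided.braided (F := F) x y)
  simpa [laxMul] using h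

end LaxBraided

/-! ### Symmetric 2-groups and change of base -/

section Induced

variable {E : Type u₁} [Category.{v₁} E] {B : Type u₂} [Category.{v₂} B] {p : E ⥤ B}

variable (p) in
/-- The inclusion of the fibre over `b`. -/
abbrev fiberIncl (b : B) : Fiber p b ⥤ E := Fiber.fiberInclusion

lemma AllCocartesian.fiberIncl_hom_ext (hp : AllCocartesian p) {b : B} {w : E} {x y : Fiber p b}
    (u : w ⟶ (fiberIncl p b).obj x) {φ ψ : x ⟶ y}
    (h : u ≫ (fiberIncl p b).map φ = u ≫ (fiberIncl p b).map ψ) : φ = ψ :=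
  hp.fiber_hom_ext u h

section Coherence

variable [CartesianMonoidalCategory E] [BraidedCategory E] {b b' : B} {f : b ⟶ b'}
  (L : CocartesianLifts p f) [MonoidalCategory (Fiber p b)] [MonoidalCategory (Fiber p b')]
  [SymmetricCategory (Fiber p b)] [SymmetricCategory (Fiber p b')]
  [(fiberIncl p b).LaxBraided] [(fiberIncl p b').LaxBraided]

/-- The coherence of the comparisons is checked on generalized elements of the form
`u ≫ ℓ`, where the `ℓ` are the chosen lifts. -/
lemma CocartesianLifts.exists_braided_of_comparison (hp : AllCocartesian p)
    (e₀ : 𝟙_ (Fiber p b') ≅ L.changeOfBase.obj (𝟙_ (Fiber p b)))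
    (he₀ : ∀ w : E, laxOne (fiberIncl p b') w ≫ (fiberIncl p b').map e₀.hom =
      laxOne (fiberIncl p b) w ≫ L.liftNatTrans.app _)
    (e : ∀ x y, L.changeOfBase.obj x ⊗ L.changeOfBase.obj y ≅ L.changeOfBase.obj (x ⊗ y))
    (he : ∀ {x y} {w : E} (u : w ⟶ (fiberIncl p b).obj x) (v : w ⟶ (fiberIncl p b).obj y),
      laxMul (fiberIncl p b') (u ≫ L.liftNatTrans.app x) (v ≫ L.liftNatTrans.app y) ≫
        (fiberIncl p b').map (e x y).hom =
          laxMul (fiberIncl p b) u v ≫ L.liftNatTrans.app _) :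
    ∃ _ : L.changeOfBase.Braided, NatTrans.IsMonoidal L.liftNatTrans := by
  have nat {x y : Fiber p b} (φ : x ⟶ y) {w : E} (u : w ⟶ (fiberIncl p b).obj x) :
      (u ≫ L.liftNatTrans.app x) ≫ (fiberIncl p b').map (L.changeOfBase.map φ) =
        (u ≫ (fiberIncl p b).map φ) ≫ L.liftNatTrans.app y := by
    rw [Category.assoc, Category.assoc]
    exact congr_arg (u ≫ ·) (L.liftNatTrans.naturality φ).symm
  let M : L.changeOfBase.CoreMonoidal :=
    { εIso := e₀
      μIso := e
      μIso_hom_natural_left := fun {x y} φ z => hp.fiberIncl_hom_ext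
          (laxMul (fiberIncl p b') (fst ((fiberIncl p b).obj x) ((fiberIncl p b).obj z) ≫
            L.liftNatTrans.app x) (snd _ _ ≫ L.liftNatTrans.app z)) <| by
        simp only [Functor.map_comp, ← Category.assoc, laxMul_map_whiskerRight, nat, he]
      μIso_hom_natural_right := fun {x y} z φ => hp.fiberIncl_hom_ext
          (laxMul (fiberIncl p b') (fst ((fiberIncl p b).obj z) ((fiberIncl p b).obj x) ≫
            L.liftNatTrans.app z) (snd _ _ ≫ L.liftNatTrans.app x)) <| by
        simp only [Functor.map_comp, ← Category.assoc, laxMul_map_whiskerLeft, nat, he]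
      associativity := fun x y z => by
        let X := (fiberIncl p b).obj x
        let Y := (fiberIncl p b).obj y
        let Z := (fiberIncl p b).obj z
        refine hp.fiberIncl_hom_ext (laxMul (fiberIncl p b') (laxMul (fiberIncl p b')
          ((fst (X ⊗ Y) Z ≫ fst X Y) ≫ L.liftNatTrans.app x)
          ((fst (X ⊗ Y) Z ≫ snd X Y) ≫ L.liftNatTrans.app y))
          (snd (X ⊗ Y) Z ≫ L.liftNatTrans.app z)) ?_
        simp only [Functor.map_comp, ← Category.assoc, laxMul_map_whiskerLeft,
          laxMul_map_whiskerRight, laxMul_map_associator, nat, he]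
      left_unitality := fun x => hp.fiberIncl_hom_ext (laxMul (fiberIncl p b') (laxOne _ _)
          (𝟙 ((fiberIncl p b).obj x) ≫ L.liftNatTrans.app x)) <| by
        simp only [Functor.map_comp, ← Category.assoc, laxMul_map_whiskerRight,
          laxMul_map_leftUnitor, nat, he, he₀]
      right_unitality := fun x => hp.fiberIncl_hom_ext (laxMul (fiberIncl p b')
          (𝟙 ((fiberIncl p b).obj x) ≫ L.liftNatTrans.app x) (laxOne _ _)) <| by
        simp only [Functor.map_comp, ← Category.assoc, laxMul_map_whiskerLeft,
          laxMul_map_rightUnitor, nat, he, he₀] }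
  let := M.toMonoidal
  refine ⟨{ braided := fun x y => ?_ }, { unit := ?_, tensor := fun x y => ?_ }⟩
  · refine hp.fiberIncl_hom_ext
      (laxMul (fiberIncl p b') (fst ((fiberIncl p b).obj x) ((fiberIncl p b).obj y) ≫
        L.liftNatTrans.app x) (snd _ _ ≫ L.liftNatTrans.app y)) ?_
    change _ ≫ (fiberIncl p b').map ((e x y).hom ≫ _) =
      _ ≫ (fiberIncl p b').map (_ ≫ (e y x).hom)
    simp only [Functor.map_comp, ← Category.assoc, laxMul_map_braiding, nat, he]
  · have h := he₀ (𝟙_ E)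
    simp only [laxOne, toUnit_unit, Category.id_comp] at h
    exact h.symm
  · have h := he (fst ((fiberIncl p b).obj x) ((fiberIncl p b).obj y)) (snd _ _)
    simp only [laxMul, lift_fst_snd, Category.id_comp, lift_fst_comp_snd_comp,
      Category.assoc] at h
    exact h.symm

end Coherence

variable [CartesianMonoidalCategory E] [CartesianMonoidalCategory B] [Preadditive B]

section

variable {b : B} [MonoidalCategory (Fiber p b)]
  [(fiberIncl p b).LaxMonoidal] {w : E} {c : B} {x y : Fiber p b}

lemma isHomLift_laxMul (hs : StrictlyPreservesFiniteProducts p)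
    (hμ : p.IsHomLift (fst b b + snd b b : b ⊗ b ⟶ b)
      (LaxMonoidal.μ (fiberIncl p b) x y))
    (f g : c ⟶ b) (u : w ⟶ (fiberIncl p b).obj x) (v : w ⟶ (fiberIncl p b).obj y)
    [p.IsHomLift f u] [p.IsHomLift g v] :
    p.IsHomLift (f + g) (laxMul (fiberIncl p b) u v) := by
  have := hs.isHomLift_lift f g u v
  have h : p.IsHomLift (lift f g ≫ (fst b b + snd b b))
      (laxMul (fiberIncl p b) u v) :=
    IsHomLift.comp p _ _ (lift u v) (LaxMonoidal.μ (fiberIncl p b) x y)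
  simpa using h

lemma isHomLift_laxOne (hs : StrictlyPreservesFiniteProducts p)
    (hε : p.IsHomLift (0 : 𝟙_ B ⟶ b) (LaxMonoidal.ε (fiberIncl p b)))
    (hw : p.obj w = c) :
    p.IsHomLift (0 : c ⟶ b) (laxOne (fiberIncl p b) w) := by
  have := hs.isHomLift_toUnit hw
  have h : p.IsHomLift (toUnit c ≫ (0 : 𝟙_ B ⟶ b))
      (laxOne (fiberIncl p b) w) :=
    IsHomLift.comp p _ _ (toUnit w) (LaxMonoidal.ε (fiberIncl p b))
  simpa using h

end

/-- The inverse of `x` is its pushforward along `-𝟙 b`: both `x ⊗ y` and the unit then receive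
a morphism from `x` lying over `𝟙 b - 𝟙 b = 0`. -/
lemma InducedSymmetricMonoidalStructure.isTwoGroup [BraidedCategory E] {b : B}
    (S : InducedSymmetricMonoidalStructure p b) (hp : AllCocartesian p) (ho : IsOpfibration p)
    (hs : StrictlyPreservesFiniteProducts p) : S.IsTwoGroup := by
  let := S.monoidal
  let := S.symmetric
  let := S.lax
  refine ⟨hp.hasGroupoidalFibres b, fun x => ?_⟩
  obtain ⟨y, n, hn⟩ := ho.exists_lift x.1 x.2 (-𝟙 b)
  have hx : p.IsHomLift (𝟙 b) (𝟙 ((fiberIncl p b).obj x)) := IsHomLift.id x.2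
  have hy : p.IsHomLift (-𝟙 b) (show (fiberIncl p b).obj x ⟶ (fiberIncl p b).obj y from n) := hn
  have h₁ := isHomLift_laxMul hs (S.μ_cocartesian x y).toIsHomLift (𝟙 b) (-𝟙 b)
    (𝟙 ((fiberIncl p b).obj x))
    (show (fiberIncl p b).obj x ⟶ (fiberIncl p b).obj y from n)
  have h₀ := isHomLift_laxOne hs S.ε_cocartesian.toIsHomLift x.2
  rw [add_neg_cancel] at h₁
  obtain ⟨e, -⟩ := hp.exists_fiber_iso (hu := h₁) (hv := h₀)
  exact ⟨y, ⟨e⟩, ⟨β_ y x ≪≫ e⟩⟩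

section ChangeOfBase

variable {b b' : B} {f : b ⟶ b'} (L : CocartesianLifts p f)
  [MonoidalCategory (Fiber p b)] [MonoidalCategory (Fiber p b')]

namespace CocartesianLifts

variable [(fiberIncl p b).LaxMonoidal] [(fiberIncl p b').LaxMonoidal]

/-- The comparison exists because `0 ≫ f = 0`. -/
lemma exists_unitIso (hp : AllCocartesian p) (hs : StrictlyPreservesFiniteProducts p)
    (hε : p.IsHomLift (0 : 𝟙_ B ⟶ b) (LaxMonoidal.ε (fiberIncl p b)))
    (hε' : p.IsHomLift (0 : 𝟙_ B ⟶ b') (LaxMonoidal.ε (fiberIncl p b'))) :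
    ∃ e : 𝟙_ (Fiber p b') ≅ L.changeOfBase.obj (𝟙_ (Fiber p b)),
      ∀ w : E, laxOne (fiberIncl p b') w ≫ (fiberIncl p b').map e.hom =
        laxOne (fiberIncl p b) w ≫ L.liftNatTrans.app _ := by
  have h₀ := isHomLift_laxOne hs hε hs.obj_unit
  have h₁ := isHomLift_laxOne hs hε' hs.obj_unit
  have hL : p.IsHomLift f (L.liftNatTrans.app (𝟙_ (Fiber p b))) := (L.cocartesian _).toIsHomLift
  have h₂ : p.IsHomLift (0 ≫ f) (laxOne (fiberIncl p b) (𝟙_ E) ≫ L.liftNatTrans.app _) :=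
    IsHomLift.comp p (0 : 𝟙_ B ⟶ b) f _ _
  rw [Limits.zero_comp] at h₂
  obtain ⟨e, he⟩ := hp.exists_fiber_iso (y := L.changeOfBase.obj (𝟙_ (Fiber p b)))
    (hu := h₁) (hv := h₂)
  refine ⟨e, fun w => ?_⟩
  have h : toUnit w ≫ laxOne (fiberIncl p b') (𝟙_ E) ≫ (fiberIncl p b').map e.hom =
      toUnit w ≫ laxOne (fiberIncl p b) (𝟙_ E) ≫ L.liftNatTrans.app _ :=
    congr_arg (toUnit w ≫ ·) he
  simpa only [← Category.assoc, comp_laxOne] using h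

/-- The comparison exists because `(fst + snd) ≫ f = fst ≫ f + snd ≫ f`. -/
lemma exists_tensorIso (hp : AllCocartesian p) (hs : StrictlyPreservesFiniteProducts p)
    (x y : Fiber p b)
    (hμ : p.IsHomLift (fst b b + snd b b : b ⊗ b ⟶ b) (LaxMonoidal.μ (fiberIncl p b) x y))
    (hμ' : p.IsHomLift (fst b' b' + snd b' b' : b' ⊗ b' ⟶ b')
      (LaxMonoidal.μ (fiberIncl p b') (L.changeOfBase.obj x) (L.changeOfBase.obj y))) :
    ∃ e : L.changeOfBase.obj x ⊗ L.changeOfBase.obj y ≅ L.changeOfBase.obj (x ⊗ y),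
      ∀ {w : E} (u : w ⟶ (fiberIncl p b).obj x) (v : w ⟶ (fiberIncl p b).obj y),
        laxMul (fiberIncl p b') (u ≫ L.liftNatTrans.app x) (v ≫ L.liftNatTrans.app y) ≫
          (fiberIncl p b').map e.hom = laxMul (fiberIncl p b) u v ≫ L.liftNatTrans.app _ := by
  have hL (x : Fiber p b) : p.IsHomLift f (L.liftNatTrans.app x) := (L.cocartesian _).toIsHomLift
  let X := (fiberIncl p b).obj x
  let Y := (fiberIncl p b).obj y
  have h₁ : p.IsHomLift (fst b b) (fst X Y) := hs.isHomLift_fst x.2 y.2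
  have h₂ : p.IsHomLift (snd b b) (snd X Y) := hs.isHomLift_snd x.2 y.2
  have h₃ := isHomLift_laxMul hs hμ' (fst b b ≫ f) (snd b b ≫ f)
    (fst X Y ≫ L.liftNatTrans.app x) (snd X Y ≫ L.liftNatTrans.app y)
  have := isHomLift_laxMul hs hμ (fst b b) (snd b b) (fst X Y) (snd X Y)
  have h₄ : p.IsHomLift ((fst b b + snd b b) ≫ f)
      (laxMul (fiberIncl p b) (fst X Y) (snd X Y) ≫ L.liftNatTrans.app _) :=
    inferInstance
  rw [Preadditive.add_comp] at h₄
  obtain ⟨e, he⟩ := hp.exists_fiber_iso (y := L.changeOfBase.obj (x ⊗ y)) (hu := h₃) (hv := h₄)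
  refine ⟨e, fun u v => ?_⟩
  have h : CartesianMonoidalCategory.lift u v ≫ laxMul (fiberIncl p b')
      (fst X Y ≫ L.liftNatTrans.app x) (snd X Y ≫ L.liftNatTrans.app y) ≫
        (fiberIncl p b').map e.hom =
      CartesianMonoidalCategory.lift u v ≫ laxMul (fiberIncl p b) (fst X Y) (snd X Y) ≫
        L.liftNatTrans.app _ := congr_arg (CartesianMonoidalCategory.lift u v ≫ ·) he
  simpa only [X, Y, ← Category.assoc, comp_laxMul, lift_fst, lift_snd] using h

end CocartesianLifts

/-- For any induced structures on the fibres, the change-of-base functors are symmetric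
monoidal. -/
lemma CocartesianLifts.isSymmetricMonoidal [BraidedCategory E] {b b' : B} {f : b ⟶ b'}
    (L : CocartesianLifts p f) (S : InducedSymmetricMonoidalStructure p b)
    (S' : InducedSymmetricMonoidalStructure p b') (hp : AllCocartesian p)
    (hs : StrictlyPreservesFiniteProducts p) : L.IsSymmetricMonoidal S S' := by
  let := S.monoidal
  let := S.symmetric
  let := S.lax
  let := S'.monoidal
  let := S'.symmetric
  let := S'.lax
  obtain ⟨e₀, he₀⟩ := L.exists_unitIso hp hs S.ε_cocartesian.toIsHomLift
    S'.ε_cocartesian.toIsHomLift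
  choose e he using fun x y => L.exists_tensorIso hp hs x y (S.μ_cocartesian x y).toIsHomLift
    (S'.μ_cocartesian _ _).toIsHomLift
  exact L.exists_braided_of_comparison hp e₀ he₀ e (fun u v => he _ _ u v)

end ChangeOfBase
end Induced

end CatFractions

open CatFractions in
theorem mainTheorem1 {X : Type u₁} [Category.{v₁} X] {B : Type u₂} [Category.{v₂} B]
    [CartesianMonoidalCategory X] [CartesianMonoidalCategory B] (P : X ⥤ B)
    (hP : IsOpfibration P) (hprod : StrictlyPreservesFiniteProducts P) :
    ∃ (_ : CartesianMonoidalCategory (Fractions P)) (_ : BraidedCategory (Fractions P)),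
      StrictlyPreservesFiniteProducts (toFractions P) ∧
      IsCartesianMonoidalOpfibration (fractionsFunctor P) ∧
      HasGroupoidalFibres (fractionsFunctor P) ∧
      ∀ [Preadditive B],
        ∃ S : ∀ b : B, InducedSymmetricMonoidalStructure (fractionsFunctor P) b,
          (∀ b : B, (S b).IsTwoGroup) ∧
          ∀ {b b' : B} (f : b ⟶ b') (L : CocartesianLifts (fractionsFunctor P) f),
            L.IsSymmetricMonoidal (S b) (S b') := by
  have hQ := preservesFiniteProducts_toFractions hP hprod
  let : CartesianMonoidalCategory (Fractions P) := fractionsCartesianMonoidalCategory hQ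
  let : BraidedCategory (Fractions P) := .ofCartesianMonoidalCategory
  have hp := hP.allCocartesian_fractionsFunctor
  have ho := hP.isOpfibration_fractionsFunctor
  have hs : StrictlyPreservesFiniteProducts (fractionsFunctor P) :=
    strictlyPreservesFiniteProducts_fractionsFunctor hQ hprod
  refine ⟨inferInstance, inferInstance, strictlyPreservesFiniteProducts_toFractions hQ,
    ⟨ho, hs, fun φ ψ _ _ => hp _⟩, hp.hasGroupoidalFibres, ?_⟩
  intro _
  let T (b : B) : FiberSum (fractionsFunctor P) b := (ho.nonempty_fiberSum b hs).some
  exact ⟨fun b => (T b).inducedSymmetricMonoidalStructure hp hs,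
    fun b => InducedSymmetricMonoidalStructure.isTwoGroup _ hp ho hs,
    fun f L => L.isSymmetricMonoidal _ _ hp hs⟩
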